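/- Let $X$ be a Banach space, $X\neq\{0\}$, and let $C\subset X$ be a closed convex cone with $C\cap(-C)=\{0\}$ and interior $C_0$. Write $x\le y$ if $y-x\in C$; for $x\in X$, $y\in C_0$ put $M(x/y)=\inf\{t\in\mathbb R: x\le ty\}$, and for $x,y\in C_0$ let $d_T(x,y)=\log\max\{M(x/y),M(y/x)\}$ be Thompson's metric. Let $J=[0,T)$ with $T\le+\infty$, let $D\subset X$ be open, and let $\phi:J\times D\to X$ be continuous and Fréchet differentiable in the second variable, with derivative $D\phi_t(x)$ such that for every closed bounded set $K\subset X$ contained in $D$ one has $\sup_{t\in J,\,x\in K}\|D\phi_t(x)\|<\infty$. For $s\in J$ and $x_0\in D$ let $t\mapsto M_s^t(x_0)$, $t\in[s,a)$, be the maximal solution in $D$ of $\dot x(t)=\phi(t,x(t))$, $x(s)=x_0$, with $[s,a)\subset J$. For an open set $U\subset D$ and $x_0\in U$ let $t_U(s,x_0)=\sup\{b\in(s,a): M_s^t(x_0)\in U\ \text{for all } t\in[s,b)\}$. Let $U\subset D\cap C_0$ be open with $\lambda U\subset U$ for all $\lambda\in(0,1]$, and suppose that the flow is order-preserving on $U$: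 for all $x_1,x_2\in U$ with $x_1\ge x_2$, one has $M_s^t(x_1)\ge M_s^t(x_2)$ whenever $s\in J$ and $s\le t<\min\{t_U(s,x_1),t_U(s,x_2)\}$. Then the best (largest) constant $\alpha$ such that, for all $x_1,x_2\in U$, $$d_T(M_s^t(x_1),M_s^t(x_2))\le e^{-\alpha(t-s)}\,d_T(x_1,x_2)\qquad\text{for all } s\in J,\ s\le t<\min\{t_U(s,x_1),t_U(s,x_2)\},$$ is $$\alpha=-\sup_{s\in J,\ x\in U} M\big((D\phi_s(x)x-\phi(s,x))/x\big).$$ Here the supremum of the real constants $\alpha$ with this property, taken in $[-\infty,+\infty]$, equals the right-hand side and is attained when it is finite; the value $-\infty$ means that no real constant has the property. -/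

import Mathlib

namespace ThompsonFlow

noncomputable section

section Cone

variable {X : Type*} [NormedAddCommGroup X] [NormedSpace ℝ X]

/-- The order of the cone: `x ≤ y` iff `y - x ∈ C`. -/
def ConeLE (C : ProperCone ℝ X) (x y : X) : Prop := y - x ∈ C

/-- `M(x/y) = inf {t ∈ ℝ : x ≤ t y}`, meant for `y` in the interior of `C`. -/
def coneM (C : ProperCone ℝ X) (x y : X) : ℝ := sInf {t : ℝ | ConeLE C x (t • y)}

/-- Thompson's part metric on the interior of `C`. -/
def thompsonDist (C : ProperCone ℝ X) (x y : X) : ℝ :=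
  Real.log (max (coneM C x y) (coneM C y x))

end Cone

/-- The interval `[s, a)` of real numbers, where `a` may be `+∞`. -/
def halfOpen (s : ℝ) (a : EReal) : Set ℝ := {t : ℝ | s ≤ t ∧ (t : EReal) < a}

section Flow

variable {X : Type*} [NormedAddCommGroup X] [NormedSpace ℝ X]

/-- `x` solves `x' = φ(t, x)`, `x(s) = x₀` on `[s, a) ⊆ J = [0, T)`, with values in `D`
(the derivative at `s` is the right derivative). The derivative of a solution is continuous as
soon as `φ` is continuous on `J × D`. -/
structure IsSolution (T : EReal) (D : Set X) (φ : ℝ → X → X) (s : ℝ) (a : EReal) (x₀ : X)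
    (x : ℝ → X) : Prop where
  lt : (s : EReal) < a
  subset : halfOpen s a ⊆ halfOpen 0 T
  init : x s = x₀
  mem : ∀ t ∈ halfOpen s a, x t ∈ D
  deriv : ∀ t ∈ halfOpen s a, HasDerivWithinAt x (φ t (x t)) (halfOpen s a) t

/-- The right end `a` of the interval `[s, a)` of the maximal solution. -/
def lifetime (T : EReal) (D : Set X) (φ : ℝ → X → X) (s : ℝ) (x₀ : X) : EReal :=
  sSup {a : EReal | ∃ x : ℝ → X, IsSolution T D φ s a x₀ x}

open Classical in
/-- The flow `M_s^t(x₀)`: the value at `t` of the solution started from `x₀` at time `s`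
(and the dummy value `x₀` when no solution reaches `t`). -/
def flow (T : EReal) (D : Set X) (φ : ℝ → X → X) (s t : ℝ) (x₀ : X) : X :=
  if h : ∃ x : ℝ → X, ∃ a : EReal, (t : EReal) < a ∧ IsSolution T D φ s a x₀ x
  then h.choose t else x₀

/-- `t_U(s, x₀)`, the first time at which the trajectory leaves `U`. -/
def exitTime (T : EReal) (D : Set X) (φ : ℝ → X → X) (U : Set X) (s : ℝ) (x₀ : X) : EReal :=
  sSup {b : EReal | (s : EReal) < b ∧ b < lifetime T D φ s x₀ ∧
    ∀ t ∈ halfOpen s b, flow T D φ s t x₀ ∈ U}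

/-- The flow is order-preserving on `U`. -/
def OrderPreservingOn (C : ProperCone ℝ X) (T : EReal) (D : Set X) (φ : ℝ → X → X)
    (U : Set X) : Prop :=
  ∀ x₁ ∈ U, ∀ x₂ ∈ U, ConeLE C x₂ x₁ → ∀ s ∈ halfOpen 0 T, ∀ t : ℝ, s ≤ t →
    (t : EReal) < min (exitTime T D φ U s x₁) (exitTime T D φ U s x₂) →
    ConeLE C (flow T D φ s t x₂) (flow T D φ s t x₁)

/-- The flow contracts Thompson's metric on `U` at the rate `α`, which may have any sign. -/
def ContractsOn (C : ProperCone ℝ X) (T : EReal) (D : Set X) (φ : ℝ → X → X)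
    (U : Set X) (α : ℝ) : Prop :=
  ∀ x₁ ∈ U, ∀ x₂ ∈ U, ∀ s ∈ halfOpen 0 T, ∀ t : ℝ, s ≤ t →
    (t : EReal) < min (exitTime T D φ U s x₁) (exitTime T D φ U s x₂) →
    thompsonDist C (flow T D φ s t x₁) (flow T D φ s t x₂) ≤
      Real.exp (-α * (t - s)) * thompsonDist C x₁ x₂

end Flow

/-- `a` is the best (largest) real constant with the property `P`: the supremum of these
constants, attained when it is finite. `a = ⊥` means that no real constant has the property. -/
def IsBestConstant (P : ℝ → Prop) (a : EReal) : Prop :=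
  IsLUB ((fun α : ℝ => (α : EReal)) '' {α : ℝ | P α}) a ∧ ∀ r : ℝ, (r : EReal) = a → P r

end

end ThompsonFlow

/-!
The contraction rate `α` is characterised by the inequality
`e^{-r} (φ(s, x) + α r x) ≤ φ(s, e^{-r} x)` for `x ∈ U` and `r ≥ 0`, a quantitative form of
subhomogeneity of the field along rays.

It is sufficient: if `x₁ ≤ e^d x₂`, it makes `e^{-ρ(t)} M_s^t(x₁)`, with
`ρ(t) = e^{-α (t - s)} d`, a subsolution of the equation, which therefore stays below
`M_s^t(x₂)` because the flow is order-preserving. Here one first worsens `α` and `d` slightly, so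
that the subsolution becomes strict and can be compared with the flow step by step, and then passes
to the limit. It is necessary: `x` and `e^{-r} x` are at distance at most `r`, and differentiating
the contraction estimate for their trajectories at `t = s` gives the inequality. Finally, its
derivative in `r` along the ray through `x` is the pointwise condition
`Dφ_s(x) x - φ(s, x) ≤ -α x`, that is `M((Dφ_s(x) x - φ(s, x))/x) ≤ -α`.
-/

open Set Filter Topology
open scoped NNReal Pointwise

namespace ThompsonFlow

section Cone

variable {X : Type*} [NormedAddCommGroup X] [NormedSpace ℝ X] {C : ProperCone ℝ X}
  {x y z : X} {r t : ℝ}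

theorem ConeLE.refl (x : X) : ConeLE C x x := by
  rw [ConeLE, sub_self]
  exact C.zero_mem

theorem ConeLE.trans (hxy : ConeLE C x y) (hyz : ConeLE C y z) : ConeLE C x z := by
  rw [ConeLE, ← sub_add_sub_cancel' y x z]
  exact C.add_mem hxy hyz

theorem ConeLE.smul (h : ConeLE C x y) (hr : 0 ≤ r) : ConeLE C (r • x) (r • y) := by
  rw [ConeLE, ← smul_sub]
  exact C.smul_mem h hr

theorem smul_coneLE_smul_right (hx : x ∈ C) (hrt : r ≤ t) : ConeLE C (r • x) (t • x) := by
  rw [ConeLE, ← sub_smul]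
  exact C.smul_mem hx (sub_nonneg.2 hrt)

theorem exp_smul_exp_neg_smul (r : ℝ) (x : X) : Real.exp r • Real.exp (-r) • x = x := by
  rw [smul_smul, ← Real.exp_add, add_neg_cancel, Real.exp_zero, one_smul]

theorem exp_neg_smul_coneLE_iff : ConeLE C (Real.exp (-r) • x) y ↔ ConeLE C x (Real.exp r • y) := by
  constructor <;> intro h
  · simpa only [exp_smul_exp_neg_smul] using h.smul (Real.exp_pos r).le
  · have hle := h.smul (Real.exp_pos (-r)).le
    rwa [smul_smul _ _ y, ← Real.exp_add, neg_add_cancel, Real.exp_zero, one_smul] at hle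

theorem smul_mem_interior (hx : x ∈ interior (C : Set X)) (hr : 0 < r) :
    r • x ∈ interior (C : Set X) := by
  have hsub : r • (C : Set X) ⊆ C := smul_set_subset_iff.2 fun _ hy => C.smul_mem hy hr.le
  exact interior_mono hsub (interior_smul₀ hr.ne' (C : Set X) ▸ smul_mem_smul_set hx)

theorem add_mem_interior (hx : x ∈ C) (hy : y ∈ interior (C : Set X)) :
    x + y ∈ interior (C : Set X) := by
  have hsub : (C : Set X) + C ⊆ C := add_subset_iff.2 fun _ ha _ hb => C.add_mem ha hb
  exact interior_mono hsub (subset_interior_add_right (add_mem_add hx hy))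

theorem exists_coneLE_smul (hy : y ∈ interior (C : Set X)) (x : X) :
    ∃ t : ℝ, ConeLE C x (t • y) := by
  have hlim : Tendsto (fun e : ℝ => y - e • x) (𝓝[>] 0) (𝓝 y) := by
    have hcont : Continuous fun e : ℝ => y - e • x := by fun_prop
    simpa using (hcont.tendsto 0).mono_left nhdsWithin_le_nhds
  obtain ⟨e, hmem, hpos : 0 < e⟩ :=
    ((hlim.eventually (mem_interior_iff_mem_nhds.1 hy)).and self_mem_nhdsWithin).exists
  have h := C.smul_mem hmem (inv_nonneg.2 hpos.le)
  rw [smul_sub, inv_smul_smul₀ hpos.ne'] at h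
  exact ⟨e⁻¹, h⟩

theorem ne_top_of_salient [Nontrivial X] (hC : ∀ x : X, x ∈ C → -x ∈ C → x = 0) : C ≠ ⊤ := by
  rintro rfl
  obtain ⟨x, hx⟩ := exists_ne (0 : X)
  exact hx (hC x ClosedSubmodule.mem_top ClosedSubmodule.mem_top)

theorem neg_notMem_of_mem_interior (hC : C ≠ ⊤) (hy : y ∈ interior (C : Set X)) : -y ∉ C := by
  intro hneg
  have hzero : (0 : X) ∈ interior (C : Set X) := neg_add_cancel y ▸ add_mem_interior hneg hy
  refine hC (eq_top_iff.2 fun x _ => ?_)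
  obtain ⟨t, ht⟩ := exists_coneLE_smul hzero (-x)
  simpa [ConeLE] using ht

theorem nonneg_of_smul_mem (hC : C ≠ ⊤) (hy : y ∈ interior (C : Set X)) (h : t • y ∈ C) :
    0 ≤ t := by
  by_contra! ht
  refine neg_notMem_of_mem_interior hC (smul_mem_interior hy (neg_pos.2 ht)) ?_
  rwa [neg_smul, neg_neg]

theorem bddBelow_setOf_coneLE_smul (hC : C ≠ ⊤) (hy : y ∈ interior (C : Set X)) (x : X) :
    BddBelow {t : ℝ | ConeLE C x (t • y)} := by
  obtain ⟨u, hu⟩ := exists_coneLE_smul hy (-x)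
  refine ⟨-u, fun t ht => ?_⟩
  have hsum : (t + u) • y ∈ C := by
    have heq : (t + u) • y = (t • y - x) + (u • y - -x) := by module
    exact heq ▸ C.add_mem ht hu
  linarith [nonneg_of_smul_mem hC hy hsum]

theorem coneLE_coneM_smul (hC : C ≠ ⊤) (hy : y ∈ interior (C : Set X)) (x : X) :
    ConeLE C x (coneM C x y • y) := by
  have hclosed : IsClosed {t : ℝ | ConeLE C x (t • y)} :=
    C.isClosed.preimage (f := fun t : ℝ => t • y - x) (by fun_prop)
  exact hclosed.csInf_mem (exists_coneLE_smul hy x) (bddBelow_setOf_coneLE_smul hC hy x)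

theorem coneM_le_iff (hC : C ≠ ⊤) (hy : y ∈ interior (C : Set X)) :
    coneM C x y ≤ t ↔ ConeLE C x (t • y) :=
  ⟨fun h => (coneLE_coneM_smul hC hy x).trans (smul_coneLE_smul_right (interior_subset hy) h),
    fun h => csInf_le (bddBelow_setOf_coneLE_smul hC hy x) h⟩

theorem coneM_pos (hC : C ≠ ⊤) (hx : x ∈ interior (C : Set X)) (hy : y ∈ interior (C : Set X)) :
    0 < coneM C x y := by
  by_contra! h
  rw [coneM_le_iff hC hy] at h
  exact neg_notMem_of_mem_interior hC hx (by simpa [ConeLE] using h)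

theorem thompsonDist_le_iff (hC : C ≠ ⊤) (hx : x ∈ interior (C : Set X))
    (hy : y ∈ interior (C : Set X)) :
    thompsonDist C x y ≤ r ↔ ConeLE C x (Real.exp r • y) ∧ ConeLE C y (Real.exp r • x) := by
  rw [thompsonDist, Real.log_le_iff_le_exp (lt_max_of_lt_left (coneM_pos hC hx hy)), max_le_iff,
    coneM_le_iff hC hy, coneM_le_iff hC hx]

theorem thompsonDist_nonneg (hC : C ≠ ⊤) (hx : x ∈ interior (C : Set X))
    (hy : y ∈ interior (C : Set X)) : 0 ≤ thompsonDist C x y := by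
  obtain ⟨hxy, hyx⟩ := (thompsonDist_le_iff hC hx hy).1 le_rfl
  set d := thompsonDist C x y
  have hself : ConeLE C x (Real.exp (d + d) • x) := by
    simpa only [Real.exp_add, mul_smul] using hxy.trans (hyx.smul (Real.exp_pos d).le)
  have hexp : 0 ≤ Real.exp (d + d) - 1 :=
    nonneg_of_smul_mem hC hx (by rwa [sub_smul, one_smul])
  linarith [Real.one_le_exp_iff.1 (sub_nonneg.1 hexp)]

theorem thompsonDist_exp_neg_smul_le (hC : C ≠ ⊤) (hx : x ∈ interior (C : Set X)) (hr : 0 ≤ r) :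
    thompsonDist C x (Real.exp (-r) • x) ≤ r := by
  rw [thompsonDist_le_iff hC hx (smul_mem_interior hx (Real.exp_pos _)), exp_smul_exp_neg_smul]
  exact ⟨.refl x,
    smul_coneLE_smul_right (interior_subset hx) (Real.exp_le_exp.2 (by linarith))⟩

theorem coneLE_of_hasDerivAt_mem {f f' : ℝ → X} {a b : ℝ} (hab : a ≤ b)
    (hcont : ContinuousOn f (Icc a b)) (hf : ∀ t ∈ Ioo a b, HasDerivAt f (f' t) t)
    (hf' : ∀ t ∈ Ioo a b, f' t ∈ C) : ConeLE C (f a) (f b) := by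
  by_contra h
  obtain ⟨l, hl, hneg⟩ := C.hyperplane_separation_point h
  have hderiv : ∀ t ∈ Ioo a b, HasDerivAt (fun t => l (f t)) (l (f' t)) t := fun t ht =>
    l.hasFDerivAt.comp_hasDerivAt t (hf t ht)
  have hmono : MonotoneOn (fun t => l (f t)) (Icc a b) := by
    refine monotoneOn_of_deriv_nonneg (convex_Icc a b) (by fun_prop) ?_ ?_ <;>
      rw [interior_Icc] <;> intro t ht
    · exact (hderiv t ht).differentiableAt.differentiableWithinAt
    · exact (hderiv t ht).deriv ▸ hl _ (hf' t ht)
  rw [map_sub] at hneg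
  linarith [hmono (left_mem_Icc.2 hab) (right_mem_Icc.2 hab) hab]

theorem mem_of_hasDerivWithinAt_of_eventually_coneLE {f : ℝ → X} {f' : X}
    (hf : HasDerivWithinAt f f' (Ici t) t) (h : ∀ᶠ u in 𝓝[>] t, ConeLE C (f t) (f u)) :
    f' ∈ C := by
  refine C.isClosed.mem_of_tendsto
    ((hasDerivWithinAt_iff_tendsto_slope' self_notMem_Ioi).1 hf.Ioi_of_Ici) ?_
  filter_upwards [h, self_mem_nhdsWithin] with u hu (htu : t < u)
  exact C.smul_mem hu (inv_nonneg.2 (sub_nonneg.2 htu.le))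

theorem eventually_coneLE_of_hasDerivWithinAt {f : ℝ → X} {f' : X}
    (hf : HasDerivWithinAt f f' (Ici t) t) (hf' : f' ∈ interior (C : Set X)) :
    ∀ᶠ u in 𝓝[>] t, ConeLE C (f t) (f u) := by
  have hslope := ((hasDerivWithinAt_iff_tendsto_slope' self_notMem_Ioi).1 hf.Ioi_of_Ici).eventually
    (mem_interior_iff_mem_nhds.1 hf')
  filter_upwards [hslope, self_mem_nhdsWithin] with u hu (htu : t < u)
  rw [ConeLE, ← vsub_eq_sub, ← sub_smul_slope]
  exact C.smul_mem hu (sub_nonneg.2 htu.le)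

end Cone

section Subhomogeneous

variable {X : Type*} [NormedAddCommGroup X] [NormedSpace ℝ X] {C : ProperCone ℝ X} {U : Set X}
  {f : X → X} {x : X} {α β r : ℝ}

/-- Subhomogeneity of `f` on `U` at rate `α`, with the scaling factor written `e^{-r}`: for `α = 0`
it says that `c f(x) ≤ f(c x)` for all `c ∈ (0, 1]`. It is the condition on a vector field which
corresponds to contraction of Thompson's metric at the rate `α` by its flow. -/
def SubhomogeneousOn (C : ProperCone ℝ X) (U : Set X) (f : X → X) (α : ℝ) : Prop :=
  ∀ x ∈ U, ∀ r : ℝ, 0 ≤ r →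
    ConeLE C (Real.exp (-r) • (f x + (α * r) • x)) (f (Real.exp (-r) • x))

theorem exp_neg_smul_mem (hUscale : ∀ l : ℝ, 0 < l → l ≤ 1 → ∀ x ∈ U, l • x ∈ U) (hx : x ∈ U)
    (hr : 0 ≤ r) : Real.exp (-r) • x ∈ U :=
  hUscale _ (Real.exp_pos _) (Real.exp_le_one_iff.2 (neg_nonpos.2 hr)) x hx

theorem hasDerivAt_exp_smul_comp_exp_neg_smul_sub
    (hf : DifferentiableAt ℝ f (Real.exp (-r) • x)) :
    HasDerivAt (fun r : ℝ => Real.exp r • f (Real.exp (-r) • x) - (α * r) • x)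
      (Real.exp r • (-α • Real.exp (-r) • x -
        (fderiv ℝ f (Real.exp (-r) • x) (Real.exp (-r) • x) - f (Real.exp (-r) • x)))) r := by
  have hray : HasDerivAt (fun r : ℝ => Real.exp (-r) • x) (-(Real.exp (-r) • x)) r := by
    simpa using (hasDerivAt_neg r).exp.smul_const x
  have hcomp := (Real.hasDerivAt_exp r).smul (hf.hasFDerivAt.comp_hasDerivAt r hray)
  refine (hcomp.sub (((hasDerivAt_id r).const_mul α).smul_const x)).congr_deriv ?_
  have hα : (α * 1) • x = α • Real.exp r • Real.exp (-r) • x := by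
    rw [exp_smul_exp_neg_smul, mul_one]
  rw [hα, map_neg]
  simp only [Function.comp_apply]
  module

theorem subhomogeneousOn_iff_fderiv
    (hUscale : ∀ l : ℝ, 0 < l → l ≤ 1 → ∀ x ∈ U, l • x ∈ U)
    (hf : ∀ x ∈ U, DifferentiableAt ℝ f x) :
    SubhomogeneousOn C U f α ↔ ∀ x ∈ U, ConeLE C (fderiv ℝ f x x - f x) (-α • x) := by
  have hderiv {x : X} (hx : x ∈ U) {r : ℝ} (hr : 0 ≤ r) :=
    hasDerivAt_exp_smul_comp_exp_neg_smul_sub (α := α) (hf _ (exp_neg_smul_mem hUscale hx hr))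
  have hiff : ∀ (x : X) (r : ℝ), ConeLE C (Real.exp (-r) • (f x + (α * r) • x))
      (f (Real.exp (-r) • x)) ↔ ConeLE C (Real.exp 0 • f (Real.exp (-0) • x) - (α * 0) • x)
        (Real.exp r • f (Real.exp (-r) • x) - (α * r) • x) := fun x r => by
    rw [exp_neg_smul_coneLE_iff]
    simp [ConeLE, sub_sub, add_comm]
  constructor
  · intro h x hx
    simpa [ConeLE] using mem_of_hasDerivWithinAt_of_eventually_coneLE
      (hderiv hx le_rfl).hasDerivWithinAt
      (eventually_of_mem self_mem_nhdsWithin fun r hr => (hiff x r).1 (h x hx r (le_of_lt hr)))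
  · intro h x hx r hr
    exact (hiff x r).2 (coneLE_of_hasDerivAt_mem hr
      (fun u hu => (hderiv hx hu.1).continuousAt.continuousWithinAt)
      (fun u hu => hderiv hx hu.1.le)
      fun u hu => C.smul_mem (h _ (exp_neg_smul_mem hUscale hx hu.1.le)) (Real.exp_pos u).le)

theorem SubhomogeneousOn.sub_mem_interior (hf : SubhomogeneousOn C U f α) (hx : x ∈ U)
    (hxC : x ∈ interior (C : Set X)) (hβ : β < α) (hr : 0 < r) :
    f (Real.exp (-r) • x) - Real.exp (-r) • (f x + (β * r) • x) ∈ interior (C : Set X) := by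
  have hgap : 0 < Real.exp (-r) * ((α - β) * r) :=
    mul_pos (Real.exp_pos _) (mul_pos (sub_pos.2 hβ) hr)
  convert add_mem_interior (hf x hx r hr.le) (smul_mem_interior hxC hgap) using 1
  module

end Subhomogeneous

section Flow

variable {X : Type*} [NormedAddCommGroup X]
  {T : EReal} {D U : Set X} {φ : ℝ → X → X} {s t : ℝ} {a b : EReal} {x₀ : X} {x y : ℝ → X}

/-- A continuous vector field on `[0, T) × D` which is locally Lipschitz in space, the neighbourhood
and the constant being uniform on a short time interval to the right: what forward local existence
and uniqueness of solutions require. The set `D` need not be open. -/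
structure IsLocallyLipschitzField (T : EReal) (D : Set X) (φ : ℝ → X → X) : Prop where
  continuousOn : ContinuousOn (fun p : ℝ × X => φ p.1 p.2) (halfOpen 0 T ×ˢ D)
  exists_lipschitzOnWith : ∀ s ∈ halfOpen 0 T, ∀ x ∈ D, ∃ K : ℝ≥0, ∃ V ∈ 𝓝[D] x,
    ∀ᶠ t in 𝓝[≥] s, LipschitzOnWith K (φ t) V

theorem left_mem_halfOpen (h : (s : EReal) < a) : s ∈ halfOpen s a := ⟨le_rfl, h⟩

theorem halfOpen_subset_halfOpen (hst : s ≤ t) (hba : b ≤ a) : halfOpen t b ⊆ halfOpen s a :=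
  fun _ h => ⟨hst.trans h.1, h.2.trans_le hba⟩

theorem Icc_subset_halfOpen (h : (t : EReal) < a) : Icc s t ⊆ halfOpen s a :=
  fun _ hr => ⟨hr.1, (EReal.coe_le_coe_iff.2 hr.2).trans_lt h⟩

theorem halfOpen_mem_nhdsGE (h : t ∈ halfOpen s a) : halfOpen s a ∈ 𝓝[≥] t := by
  obtain ⟨r, htr, hra⟩ := EReal.lt_iff_exists_real_btwn.1 h.2
  exact mem_of_superset (Icc_mem_nhdsGE (EReal.coe_lt_coe_iff.1 htr))
    ((Icc_subset_halfOpen hra).trans (halfOpen_subset_halfOpen h.1 le_rfl))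

theorem IsLocallyLipschitzField.mono (hφ : IsLocallyLipschitzField T D φ) (hUD : U ⊆ D) :
    IsLocallyLipschitzField T U φ where
  continuousOn := hφ.continuousOn.mono (prod_mono_right hUD)
  exists_lipschitzOnWith s hs x hx := by
    obtain ⟨K, V, hV, hK⟩ := hφ.exists_lipschitzOnWith s hs x (hUD hx)
    exact ⟨K, V, nhdsWithin_mono x hUD hV, hK⟩

theorem IsLocallyLipschitzField.exists_closedBall (hφ : IsLocallyLipschitzField T U φ)
    (hU : IsOpen U) (hs : s ∈ halfOpen 0 T) (hx₀ : x₀ ∈ U) :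
    ∃ K : ℝ≥0, ∃ R > 0, Metric.closedBall x₀ R ⊆ U ∧ ∀ᶠ t in 𝓝[≥] s,
      LipschitzOnWith K (φ t) (Metric.closedBall x₀ R) ∧
        ∀ x ∈ Metric.closedBall x₀ R, ‖φ t x‖ ≤ ‖φ s x₀‖ + 1 := by
  obtain ⟨K, V, hV, hK⟩ := hφ.exists_lipschitzOnWith s hs x₀ hx₀
  have hnorm : ∀ᶠ p in 𝓝[halfOpen 0 T] s ×ˢ 𝓝[U] x₀, ‖φ p.1 p.2‖ ≤ ‖φ s x₀‖ + 1 := by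
    rw [← nhdsWithin_prod_eq]
    exact (hφ.continuousOn (s, x₀) ⟨hs, hx₀⟩).norm.eventually_le_const (lt_add_one ‖φ s x₀‖)
  obtain ⟨P, hP, Q, hQ, hPQ⟩ := eventually_prod_iff.1 hnorm
  rw [hU.nhdsWithin_eq hx₀] at hV hQ
  obtain ⟨R, hR, hRsub⟩ := Metric.nhds_basis_closedBall.mem_iff.1
    (inter_mem (inter_mem (hU.mem_nhds hx₀) hV) hQ)
  refine ⟨K, R, hR, fun x hx => (hRsub hx).1.1, ?_⟩
  have hPs : ∀ᶠ t in 𝓝[≥] s, P t := hP.filter_mono (nhdsWithin_le_iff.2 (halfOpen_mem_nhdsGE hs))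
  filter_upwards [hK, hPs] with t hKt hPt
  exact ⟨hKt.mono fun x hx => (hRsub hx).1.2, fun x hx => hPQ hPt (hRsub hx).2⟩

theorem IsLocallyLipschitzField.exists_isPicardLindelof (hφ : IsLocallyLipschitzField T U φ)
    (hU : IsOpen U) (hs : s ∈ halfOpen 0 T) (hx₀ : x₀ ∈ U) :
    ∃ m : ℝ, ∃ hm : s < m, Icc s m ⊆ halfOpen 0 T ∧ ∃ R L K : ℝ≥0,
      IsPicardLindelof φ (⟨s, left_mem_Icc.2 hm.le⟩ : Icc s m) x₀ R 0 L K := by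
  obtain ⟨K, R, hR, hRU, hev⟩ := hφ.exists_closedBall hU hs hx₀
  obtain ⟨p, hsp : s < p, hp⟩ := mem_nhdsGE_iff_exists_Icc_subset.1
    (hev.and (halfOpen_mem_nhdsGE hs))
  set L := ‖φ s x₀‖ + 1
  have hL : 0 < L := by positivity
  have hm : s < min p (s + R / L) := lt_min hsp (lt_add_of_pos_right s (div_pos hR hL))
  have hsub : Icc s (min p (s + R / L)) ⊆ Icc s p := Icc_subset_Icc_right (min_le_left _ _)
  have hlength : L * (min p (s + R / L) - s) ≤ R := by
    rw [mul_comm, ← le_div_iff₀ hL]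
    linarith [min_le_right p (s + R / L)]
  exact ⟨_, hm, fun t ht => (hp (hsub ht)).2, ⟨R, hR.le⟩, ⟨L, hL.le⟩, K,
    { lipschitzOnWith := fun t ht => (hp (hsub ht)).1.1
      continuousOn := fun x hx => hφ.continuousOn.comp (f := fun t : ℝ => (t, x)) (by fun_prop)
        fun t ht => ⟨(hp (hsub ht)).2, hRU hx⟩
      norm_le := fun t ht => (hp (hsub ht)).1.2
      mul_max_le := by simpa [max_eq_left (sub_nonneg.2 hm.le)] using! hlength }⟩

variable [NormedSpace ℝ X]

theorem isLocallyLipschitzField_of_norm_fderiv_le (hD : IsOpen D)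
    (hcont : ContinuousOn (fun p : ℝ × X => φ p.1 p.2) (halfOpen 0 T ×ˢ D))
    (hdiff : ∀ t ∈ halfOpen 0 T, ∀ x ∈ D, DifferentiableAt ℝ (φ t) x)
    (hbound : ∀ K : Set X, K ⊆ D → IsClosed K → Bornology.IsBounded K →
      ∃ L : ℝ, ∀ t ∈ halfOpen 0 T, ∀ x ∈ K, ‖fderiv ℝ (φ t) x‖ ≤ L) :
    IsLocallyLipschitzField T D φ where
  continuousOn := hcont
  exists_lipschitzOnWith s hs x hx := by
    obtain ⟨R, hR, hRD⟩ := Metric.nhds_basis_closedBall.mem_iff.1 (hD.mem_nhds hx)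
    obtain ⟨L, hL⟩ := hbound _ hRD Metric.isClosed_closedBall Metric.isBounded_closedBall
    refine ⟨L.toNNReal, _, mem_nhdsWithin_of_mem_nhds (Metric.closedBall_mem_nhds x hR), ?_⟩
    filter_upwards [halfOpen_mem_nhdsGE hs] with t ht
    exact (convex_closedBall x R).lipschitzOnWith_of_nnnorm_fderiv_le
      (fun y hy => hdiff t ht y (hRD hy)) fun y hy => NNReal.le_toNNReal_of_coe_le (hL t ht y hy)

theorem IsLocallyLipschitzField.exists_isSolution [CompleteSpace X]
    (hφ : IsLocallyLipschitzField T U φ) (hU : IsOpen U) (hs : s ∈ halfOpen 0 T) (hx₀ : x₀ ∈ U) :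
    ∃ b : EReal, ∃ x : ℝ → X, IsSolution T U φ s b x₀ x := by
  obtain ⟨m, hm, hmT, R, L, K, hpl⟩ := hφ.exists_isPicardLindelof hU hs hx₀
  obtain ⟨x, hxs : x s = x₀, hx⟩ := hpl.exists_eq_forall_mem_Icc_hasDerivWithinAt₀
  have hcont : ContinuousWithinAt x (Ici s) s :=
    (hx s (left_mem_Icc.2 hm.le)).continuousWithinAt.mono_of_mem_nhdsWithin (Icc_mem_nhdsGE hm)
  obtain ⟨q, hsq : s < q, hq⟩ := mem_nhdsGE_iff_exists_Icc_subset.1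
    (inter_mem (hcont (hU.mem_nhds (hxs ▸ hx₀))) (Icc_mem_nhdsGE hm))
  have hsub : halfOpen s q ⊆ Icc s q := fun t ht => ⟨ht.1, (EReal.coe_lt_coe_iff.1 ht.2).le⟩
  exact ⟨q, x,
    { lt := EReal.coe_lt_coe_iff.2 hsq
      subset := fun t ht => hmT (hq (hsub ht)).2
      init := hxs
      mem := fun t ht => (hq (hsub ht)).1
      deriv := fun t ht => (hx t (hq (hsub ht)).2).mono fun u hu => (hq (hsub hu)).2 }⟩

theorem IsSolution.mono (hx : IsSolution T U φ s a x₀ x) (hUD : U ⊆ D) :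
    IsSolution T D φ s a x₀ x :=
  { hx with mem := fun t ht => hUD (hx.mem t ht) }

theorem IsSolution.restrict (hx : IsSolution T D φ s a x₀ x) (hst : s ≤ t) (htb : (t : EReal) < b)
    (hba : b ≤ a) : IsSolution T D φ t b (x t) x where
  lt := htb
  subset := (halfOpen_subset_halfOpen hst hba).trans hx.subset
  init := rfl
  mem r hr := hx.mem r (halfOpen_subset_halfOpen hst hba hr)
  deriv r hr := (hx.deriv r (halfOpen_subset_halfOpen hst hba hr)).mono
    (halfOpen_subset_halfOpen hst hba)

theorem IsSolution.hasDerivWithinAt_Ici (hx : IsSolution T D φ s a x₀ x) (ht : t ∈ halfOpen s a) :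
    HasDerivWithinAt x (φ t (x t)) (Ici t) t :=
  (hx.deriv t ht).mono_of_mem_nhdsWithin (halfOpen_mem_nhdsGE ht)

theorem IsSolution.hasDerivWithinAt_Ici_left (hx : IsSolution T D φ s a x₀ x) :
    HasDerivWithinAt x (φ s x₀) (Ici s) s :=
  hx.init ▸ hx.hasDerivWithinAt_Ici (left_mem_halfOpen hx.lt)

theorem IsSolution.continuousOn_Icc (hx : IsSolution T D φ s a x₀ x) (ht : (t : EReal) < a) :
    ContinuousOn x (Icc s t) := fun r hr =>
  (hx.deriv r (Icc_subset_halfOpen ht hr)).continuousWithinAt.mono (Icc_subset_halfOpen ht)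

theorem IsSolution.tendsto_nhdsWithin (hx : IsSolution T D φ s a x₀ x) :
    Tendsto x (𝓝[≥] s) (𝓝[D] x₀) := by
  refine tendsto_nhdsWithin_iff.2 ⟨?_, ?_⟩
  · simpa only [hx.init] using hx.hasDerivWithinAt_Ici_left.continuousWithinAt.tendsto
  · filter_upwards [halfOpen_mem_nhdsGE (left_mem_halfOpen hx.lt)] with t ht using hx.mem t ht

theorem IsSolution.eventuallyEq (hφ : IsLocallyLipschitzField T D φ)
    (hx : IsSolution T D φ s a x₀ x) (hy : IsSolution T D φ s b x₀ y) : x =ᶠ[𝓝[≥] s] y := by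
  have hsa := left_mem_halfOpen hx.lt
  have hsb := left_mem_halfOpen hy.lt
  obtain ⟨K, V, hV, hK⟩ := hφ.exists_lipschitzOnWith s (hx.subset hsa) x₀
    (hx.init ▸ hx.mem s hsa)
  obtain ⟨m, hsm : s < m, hm⟩ := mem_nhdsGE_iff_exists_Icc_subset.1
    ((hK.and ((hx.tendsto_nhdsWithin.eventually_mem hV).and
      (hy.tendsto_nhdsWithin.eventually_mem hV))).and
      (inter_mem (halfOpen_mem_nhdsGE hsa) (halfOpen_mem_nhdsGE hsb)))
  have hIco : ∀ t ∈ Ico s m, t ∈ Icc s m := fun t ht => Ico_subset_Icc_self ht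
  have heq : EqOn x y (Icc s m) := ODE_solution_unique_of_mem_Icc_right (v := φ) (K := K)
    (s := fun _ => V) (fun t ht => (hm (hIco t ht)).1.1)
    (hx.continuousOn_Icc (hm (right_mem_Icc.2 hsm.le)).2.1.2)
    (fun t ht => hx.hasDerivWithinAt_Ici (hm (hIco t ht)).2.1)
    (fun t ht => (hm (hIco t ht)).1.2.1)
    (hy.continuousOn_Icc (hm (right_mem_Icc.2 hsm.le)).2.2.2)
    (fun t ht => hy.hasDerivWithinAt_Ici (hm (hIco t ht)).2.2)
    (fun t ht => (hm (hIco t ht)).1.2.2) (hx.init.trans hy.init.symm)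
  exact eventually_of_mem (Icc_mem_nhdsGE hsm) heq

theorem IsSolution.eqOn (hφ : IsLocallyLipschitzField T D φ)
    (hx : IsSolution T D φ s a x₀ x) (hy : IsSolution T D φ s b x₀ y) :
    EqOn x y (halfOpen s a ∩ halfOpen s b) := by
  rintro t ⟨⟨hst, hta⟩, -, htb⟩
  have hclosed : IsClosed ({r | x r = y r} ∩ Icc s t) := by
    rw [inter_comm]
    exact ((hx.continuousOn_Icc hta).prodMk (hy.continuousOn_Icc htb)).preimage_isClosed_of_isClosed
      isClosed_Icc isClosed_diagonal
  refine hclosed.Icc_subset_of_forall_mem_nhdsWithin (hx.init.trans hy.init.symm) ?_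
    (right_mem_Icc.2 hst)
  rintro r ⟨hr : x r = y r, hsr, hrt⟩
  have hrt' : (r : EReal) < t := EReal.coe_lt_coe_iff.2 hrt
  have hyr := hy.restrict hsr (hrt'.trans htb) le_rfl
  rw [← hr] at hyr
  exact ((hx.restrict hsr (hrt'.trans hta) le_rfl).eventuallyEq hφ hyr).filter_mono
    (nhdsWithin_mono r Ioi_subset_Ici_self)

theorem IsSolution.flow_eq (hφ : IsLocallyLipschitzField T D φ)
    (hx : IsSolution T D φ s a x₀ x) (ht : t ∈ halfOpen s a) : flow T D φ s t x₀ = x t := by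
  have h : ∃ x : ℝ → X, ∃ a : EReal, (t : EReal) < a ∧ IsSolution T D φ s a x₀ x :=
    ⟨x, a, ht.2, hx⟩
  obtain ⟨c, htc, hc⟩ := h.choose_spec
  rw [flow, dif_pos h]
  exact hc.eqOn hφ hx ⟨⟨ht.1, htc⟩, ht⟩

theorem lt_exitTime_iff (hφ : IsLocallyLipschitzField T D φ) (hUD : U ⊆ D) (hst : s ≤ t) :
    (t : EReal) < exitTime T D φ U s x₀ ↔
      ∃ b : EReal, ∃ x : ℝ → X, (t : EReal) < b ∧ IsSolution T U φ s b x₀ x := by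
  constructor
  · intro h
    obtain ⟨b, ⟨hsb, hb, hbU⟩, htb⟩ := lt_sSup_iff.1 h
    obtain ⟨a, ⟨x, hx⟩, hba⟩ := lt_sSup_iff.1 hb
    have hxb : IsSolution T D φ s b x₀ x := hx.init ▸ hx.restrict le_rfl hsb hba.le
    exact ⟨b, x, htb, { hxb with mem := fun r hr => hxb.flow_eq hφ hr ▸ hbU r hr }⟩
  · rintro ⟨a, x, hta, hx⟩
    obtain ⟨b, htb, hba⟩ := exists_between hta
    refine htb.trans_le (le_sSup ⟨(EReal.coe_le_coe_iff.2 hst).trans_lt htb,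
      hba.trans_le (le_sSup ⟨x, hx.mono hUD⟩), fun r hr => ?_⟩)
    have hra := halfOpen_subset_halfOpen le_rfl hba.le hr
    exact (hx.mono hUD).flow_eq hφ hra ▸ hx.mem r hra

end Flow

section Contraction

variable {X : Type*} [NormedAddCommGroup X] [NormedSpace ℝ X] {C : ProperCone ℝ X}
  {T : EReal} {D U : Set X} {φ : ℝ → X → X} {s t α : ℝ} {a b : EReal} {x₁ x₂ : X} {z w : ℝ → X}

theorem OrderPreservingOn.coneLE (hmono : OrderPreservingOn C T D φ U)
    (hφ : IsLocallyLipschitzField T D φ) (hUD : U ⊆ D) (hz : IsSolution T U φ s a x₁ z)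
    (hw : IsSolution T U φ s b x₂ w) (hta : t ∈ halfOpen s a) (htb : t ∈ halfOpen s b)
    (h : ConeLE C x₁ x₂) : ConeLE C (z t) (w t) := by
  have hsa := left_mem_halfOpen hz.lt
  rw [← (hz.mono hUD).flow_eq hφ hta, ← (hw.mono hUD).flow_eq hφ htb]
  exact hmono x₂ (hw.init ▸ hw.mem s (left_mem_halfOpen hw.lt)) x₁ (hz.init ▸ hz.mem s hsa) h s
    (hz.subset hsa) t hta.1 (lt_min ((lt_exitTime_iff hφ hUD hta.1).2 ⟨b, w, htb.2, hw⟩)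
      ((lt_exitTime_iff hφ hUD hta.1).2 ⟨a, z, hta.2, hz⟩))

theorem contractsOn_iff_forall_isSolution (hφ : IsLocallyLipschitzField T D φ) (hUD : U ⊆ D) :
    ContractsOn C T D φ U α ↔ ∀ ⦃x₁ x₂ : X⦄ ⦃s : ℝ⦄ ⦃a b : EReal⦄ ⦃z w : ℝ → X⦄,
      IsSolution T U φ s a x₁ z → IsSolution T U φ s b x₂ w →
      ∀ t ∈ halfOpen s a ∩ halfOpen s b,
        thompsonDist C (z t) (w t) ≤ Real.exp (-α * (t - s)) * thompsonDist C x₁ x₂ := by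
  constructor
  · rintro h x₁ x₂ s a b z w hz hw t ⟨hta, htb⟩
    have hsa := left_mem_halfOpen hz.lt
    rw [← (hz.mono hUD).flow_eq hφ hta, ← (hw.mono hUD).flow_eq hφ htb]
    exact h x₁ (hz.init ▸ hz.mem s hsa) x₂ (hw.init ▸ hw.mem s (left_mem_halfOpen hw.lt)) s
      (hz.subset hsa) t hta.1 (lt_min ((lt_exitTime_iff hφ hUD hta.1).2 ⟨a, z, hta.2, hz⟩)
        ((lt_exitTime_iff hφ hUD hta.1).2 ⟨b, w, htb.2, hw⟩))
  · intro h x₁ _ x₂ _ s _ t hst ht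
    obtain ⟨a, z, hta, hz⟩ := (lt_exitTime_iff hφ hUD hst).1 (lt_min_iff.1 ht).1
    obtain ⟨b, w, htb, hw⟩ := (lt_exitTime_iff hφ hUD hst).1 (lt_min_iff.1 ht).2
    rw [(hz.mono hUD).flow_eq hφ ⟨hst, hta⟩, (hw.mono hUD).flow_eq hφ ⟨hst, htb⟩]
    exact h hz hw t ⟨⟨hst, hta⟩, ⟨hst, htb⟩⟩

theorem eventually_coneLE_of_strict_subsolution [CompleteSpace X]
    (hφ : IsLocallyLipschitzField T D φ) (hU : IsOpen U) (hUD : U ⊆ D)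
    (hmono : OrderPreservingOn C T D φ U) {y : ℝ → X} {y' : X} (hw : IsSolution T U φ s b x₂ w)
    (hyU : y s ∈ U) (hy : HasDerivWithinAt y y' (Ici s) s)
    (hy' : φ s (y s) - y' ∈ interior (C : Set X)) (hs : ConeLE C (y s) x₂) :
    ∀ᶠ t in 𝓝[>] s, ConeLE C (y t) (w t) := by
  have hsb := left_mem_halfOpen hw.lt
  obtain ⟨c, v, hv⟩ := (hφ.mono hUD).exists_isSolution hU (hw.subset hsb) hyU
  have hyv : ∀ᶠ t in 𝓝[>] s, ConeLE C (v s - y s) (v t - y t) :=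
    eventually_coneLE_of_hasDerivWithinAt (hv.hasDerivWithinAt_Ici_left.sub hy) hy'
  have hle : 𝓝[>] s ≤ 𝓝[≥] s := nhdsWithin_mono s Ioi_subset_Ici_self
  filter_upwards [hyv, hle (halfOpen_mem_nhdsGE hsb),
    hle (halfOpen_mem_nhdsGE (left_mem_halfOpen hv.lt))] with t hyvt htb htc
  rw [hv.init, sub_self, ConeLE, sub_zero] at hyvt
  exact ConeLE.trans hyvt (hmono.coneLE hφ hUD hv hw htc htb hs)

theorem coneLE_of_strict_subsolution [CompleteSpace X] (hφ : IsLocallyLipschitzField T D φ)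
    (hU : IsOpen U) (hUD : U ⊆ D) (hmono : OrderPreservingOn C T D φ U) {y y' : ℝ → X}
    (hw : IsSolution T U φ s b x₂ w) (hst : s ≤ t) (htb : (t : EReal) < b)
    (hyU : ∀ r ∈ Ico s t, y r ∈ U) (hyc : ContinuousOn y (Icc s t))
    (hy : ∀ r ∈ Ico s t, HasDerivWithinAt y (y' r) (Ici r) r)
    (hy' : ∀ r ∈ Ico s t, φ r (y r) - y' r ∈ interior (C : Set X)) (hs : ConeLE C (y s) x₂) :
    ConeLE C (y t) (w t) := by
  have hclosed : IsClosed ({r | ConeLE C (y r) (w r)} ∩ Icc s t) := by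
    rw [inter_comm]
    exact ((hw.continuousOn_Icc htb).sub hyc).preimage_isClosed_of_isClosed isClosed_Icc C.isClosed
  refine hclosed.Icc_subset_of_forall_mem_nhdsWithin (show ConeLE C (y s) (w s) from hw.init ▸ hs)
    ?_ (right_mem_Icc.2 hst)
  rintro r ⟨hr, hrst⟩
  have hrb : (r : EReal) < b := (EReal.coe_lt_coe_iff.2 hrst.2).trans htb
  exact eventually_coneLE_of_strict_subsolution hφ hU hUD hmono (hw.restrict hrst.1 hrb le_rfl)
    (hyU r hrst) (hy r hrst) (hy' r hrst) hr

theorem coneLE_exp_smul_of_lt_rate [CompleteSpace X] (hφ : IsLocallyLipschitzField T D φ)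
    (hU : IsOpen U) (hUD : U ⊆ D) (hUC : U ⊆ interior (C : Set X))
    (hUscale : ∀ l : ℝ, 0 < l → l ≤ 1 → ∀ x ∈ U, l • x ∈ U)
    (hmono : OrderPreservingOn C T D φ U)
    (hα : ∀ s ∈ halfOpen 0 T, SubhomogeneousOn C U (φ s) α) (hz : IsSolution T U φ s a x₁ z)
    (hw : IsSolution T U φ s b x₂ w) (hta : t ∈ halfOpen s a) (htb : t ∈ halfOpen s b)
    {β d : ℝ} (hβ : β < α) (hd : 0 < d) (h : ConeLE C x₁ (Real.exp d • x₂)) :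
    ConeLE C (z t) (Real.exp (Real.exp (-β * (t - s)) * d) • w t) := by
  set ρ : ℝ → ℝ := fun r => Real.exp (-β * (r - s)) * d with hρ
  have hρpos : ∀ r, 0 < ρ r := fun r => mul_pos (Real.exp_pos _) hd
  have hρderiv : ∀ r, HasDerivAt ρ (-β * ρ r) r := fun r =>
    (((((hasDerivAt_id r).sub_const s).const_mul (-β)).exp).mul_const d).congr_deriv <| by
      simp only [hρ, id]
      ring
  have hmem : ∀ r ∈ Ico s t, r ∈ halfOpen s a := fun r hr =>
    Icc_subset_halfOpen hta.2 (Ico_subset_Icc_self hr)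
  have hderiv : ∀ r ∈ Ico s t, HasDerivWithinAt (fun r => Real.exp (-ρ r) • z r)
      (Real.exp (-ρ r) • (φ r (z r) + (β * ρ r) • z r)) (Ici r) r := fun r hr =>
    ((hρderiv r).neg.exp.hasDerivWithinAt.smul
      (hz.hasDerivWithinAt_Ici (hmem r hr))).congr_deriv <| by
        simp only [Pi.neg_apply]
        module
  have hcont : ContinuousOn (fun r => Real.exp (-ρ r) • z r) (Icc s t) :=
    (by fun_prop : Continuous fun r => Real.exp (-ρ r)).continuousOn.smul
      (hz.continuousOn_Icc hta.2)
  refine exp_neg_smul_coneLE_iff.1 (coneLE_of_strict_subsolution hφ hU hUD hmono hw hta.1 htb.2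
    (fun r hr => exp_neg_smul_mem hUscale (hz.mem r (hmem r hr)) (hρpos r).le) hcont hderiv
    (fun r hr => (hα r (hz.subset (hmem r hr))).sub_mem_interior (hz.mem r (hmem r hr))
      (hUC (hz.mem r (hmem r hr))) hβ (hρpos r)) ?_)
  simpa [hρ, hz.init] using exp_neg_smul_coneLE_iff.2 h

theorem coneLE_exp_smul [CompleteSpace X] (hφ : IsLocallyLipschitzField T D φ)
    (hU : IsOpen U) (hUD : U ⊆ D) (hUC : U ⊆ interior (C : Set X))
    (hUscale : ∀ l : ℝ, 0 < l → l ≤ 1 → ∀ x ∈ U, l • x ∈ U)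
    (hmono : OrderPreservingOn C T D φ U)
    (hα : ∀ s ∈ halfOpen 0 T, SubhomogeneousOn C U (φ s) α) (hz : IsSolution T U φ s a x₁ z)
    (hw : IsSolution T U φ s b x₂ w) (hta : t ∈ halfOpen s a) (htb : t ∈ halfOpen s b)
    {d : ℝ} (hd : 0 ≤ d) (h : ConeLE C x₁ (Real.exp d • x₂)) :
    ConeLE C (z t) (Real.exp (Real.exp (-α * (t - s)) * d) • w t) := by
  have hx₂ : x₂ ∈ C :=
    interior_subset (hUC (hw.init ▸ hw.mem s (left_mem_halfOpen hw.lt)))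
  have hperturbed : Ioi (0 : ℝ) ⊆
      {ε | ConeLE C (z t) (Real.exp (Real.exp (-(α - ε) * (t - s)) * (d + ε)) • w t)} :=
    fun ε (hε : 0 < ε) => coneLE_exp_smul_of_lt_rate hφ hU hUD hUC hUscale hmono hα hz hw hta htb
      (by linarith) (by linarith)
      (h.trans (smul_coneLE_smul_right hx₂ (Real.exp_le_exp.2 (by linarith))))
  have hclosed : IsClosed
      {ε | ConeLE C (z t) (Real.exp (Real.exp (-(α - ε) * (t - s)) * (d + ε)) • w t)} :=
    C.isClosed.preimage (by fun_prop)
  have hzero : (0 : ℝ) ∈ closure (Ioi 0) := by simp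
  simpa using closure_minimal hperturbed hclosed hzero

theorem contractsOn_of_subhomogeneousOn [CompleteSpace X] (hC : C ≠ ⊤)
    (hφ : IsLocallyLipschitzField T D φ) (hU : IsOpen U) (hUD : U ⊆ D)
    (hUC : U ⊆ interior (C : Set X)) (hUscale : ∀ l : ℝ, 0 < l → l ≤ 1 → ∀ x ∈ U, l • x ∈ U)
    (hmono : OrderPreservingOn C T D φ U)
    (hα : ∀ s ∈ halfOpen 0 T, SubhomogeneousOn C U (φ s) α) : ContractsOn C T D φ U α := by
  rw [contractsOn_iff_forall_isSolution hφ hUD]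
  rintro x₁ x₂ s a b z w hz hw t ⟨hta, htb⟩
  have hx₁ := hUC (hz.init ▸ hz.mem s (left_mem_halfOpen hz.lt))
  have hx₂ := hUC (hw.init ▸ hw.mem s (left_mem_halfOpen hw.lt))
  have hd := thompsonDist_nonneg hC hx₁ hx₂
  obtain ⟨h₁₂, h₂₁⟩ := (thompsonDist_le_iff hC hx₁ hx₂).1 le_rfl
  rw [thompsonDist_le_iff hC (hUC (hz.mem t hta)) (hUC (hw.mem t htb))]
  exact ⟨coneLE_exp_smul hφ hU hUD hUC hUscale hmono hα hz hw hta htb hd h₁₂,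
    coneLE_exp_smul hφ hU hUD hUC hUscale hmono hα hw hz htb hta hd h₂₁⟩

theorem ContractsOn.subhomogeneousOn [CompleteSpace X] (hC : C ≠ ⊤)
    (hφ : IsLocallyLipschitzField T D φ) (hU : IsOpen U) (hUD : U ⊆ D)
    (hUC : U ⊆ interior (C : Set X)) (hUscale : ∀ l : ℝ, 0 < l → l ≤ 1 → ∀ x ∈ U, l • x ∈ U)
    (h : ContractsOn C T D φ U α) (hs : s ∈ halfOpen 0 T) : SubhomogeneousOn C U (φ s) α := by
  intro x hx r hr
  rw [contractsOn_iff_forall_isSolution hφ hUD] at h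
  obtain ⟨a, z, hz⟩ := (hφ.mono hUD).exists_isSolution hU hs hx
  obtain ⟨b, w, hw⟩ := (hφ.mono hUD).exists_isSolution hU hs (exp_neg_smul_mem hUscale hx hr)
  set c : ℝ → ℝ := fun t => Real.exp (Real.exp (-α * (t - s)) * r) with hc
  have hcs : c s = Real.exp r := by simp [hc]
  have hcderiv : HasDerivAt c (Real.exp r * (-α * r)) s := by
    simpa [hc] using (((((hasDerivAt_id s).sub_const s).const_mul (-α)).exp).mul_const r).exp
  have hstart : c s • w s - z s = 0 := by
    rw [hcs, hw.init, hz.init, exp_smul_exp_neg_smul, sub_self]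
  have hle : 𝓝[>] s ≤ 𝓝[≥] s := nhdsWithin_mono s Ioi_subset_Ici_self
  have hev : ∀ᶠ t in 𝓝[>] s, ConeLE C (c s • w s - z s) (c t • w t - z t) := by
    filter_upwards [hle (halfOpen_mem_nhdsGE (left_mem_halfOpen hz.lt)),
      hle (halfOpen_mem_nhdsGE (left_mem_halfOpen hw.lt))] with t hta htb
    have hdist : thompsonDist C (z t) (w t) ≤ Real.exp (-α * (t - s)) * r :=
      (h hz hw t ⟨hta, htb⟩).trans (mul_le_mul_of_nonneg_left
        (thompsonDist_exp_neg_smul_le hC (hUC hx) hr) (Real.exp_pos _).le)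
    rw [hstart, ConeLE, sub_zero]
    exact ((thompsonDist_le_iff hC (hUC (hz.mem t hta)) (hUC (hw.mem t htb))).1 hdist).1
  have hmem := mem_of_hasDerivWithinAt_of_eventually_coneLE
    ((hcderiv.hasDerivWithinAt.smul hw.hasDerivWithinAt_Ici_left).sub hz.hasDerivWithinAt_Ici_left)
    hev
  have hscale : (Real.exp r * (-α * r)) • Real.exp (-r) • x = (-α * r) • x := by
    rw [mul_comm, mul_smul, exp_smul_exp_neg_smul]
  rw [hcs, hw.init, hscale] at hmem
  rw [exp_neg_smul_coneLE_iff, ConeLE]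
  convert hmem using 1
  module

theorem contractsOn_iff_subhomogeneousOn [CompleteSpace X] (hC : C ≠ ⊤)
    (hφ : IsLocallyLipschitzField T D φ) (hU : IsOpen U) (hUD : U ⊆ D)
    (hUC : U ⊆ interior (C : Set X)) (hUscale : ∀ l : ℝ, 0 < l → l ≤ 1 → ∀ x ∈ U, l • x ∈ U)
    (hmono : OrderPreservingOn C T D φ U) :
    ContractsOn C T D φ U α ↔ ∀ s ∈ halfOpen 0 T, SubhomogeneousOn C U (φ s) α :=
  ⟨fun h _ hs => h.subhomogeneousOn hC hφ hU hUD hUC hUscale hs,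
    contractsOn_of_subhomogeneousOn hC hφ hU hUD hUC hUscale hmono⟩

theorem isBestConstant_of_forall_iff_le {P : ℝ → Prop} {a : EReal}
    (h : ∀ α : ℝ, P α ↔ (α : EReal) ≤ a) : IsBestConstant P a := by
  refine ⟨⟨?_, fun b hb => ?_⟩, fun r hr => (h r).2 hr.le⟩
  · rintro _ ⟨α, hα, rfl⟩
    exact (h α).1 hα
  · by_contra! hlt
    obtain ⟨r, hbr, hra⟩ := EReal.lt_iff_exists_real_btwn.1 hlt
    exact (hb ⟨r, (h r).2 hra.le, rfl⟩).not_gt hbr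

end Contraction

end ThompsonFlow

open ThompsonFlow

theorem mainTheorem1_general {X : Type*} [NormedAddCommGroup X] [NormedSpace ℝ X] [CompleteSpace X]
    {C : ProperCone ℝ X} (hC : C ≠ ⊤) {T : EReal} {D : Set X} {φ : ℝ → X → X}
    (hφ : IsLocallyLipschitzField T D φ) {U : Set X} (hU : IsOpen U) (hUD : U ⊆ D)
    (hUC : U ⊆ interior (C : Set X)) (hUscale : ∀ l : ℝ, 0 < l → l ≤ 1 → ∀ x ∈ U, l • x ∈ U)
    (hdiff : ∀ t ∈ halfOpen 0 T, ∀ x ∈ U, DifferentiableAt ℝ (φ t) x)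
    (hmono : OrderPreservingOn C T D φ U) :
    IsBestConstant (ContractsOn C T D φ U)
      (-(⨆ s ∈ halfOpen 0 T, ⨆ x ∈ U,
        ((coneM C (fderiv ℝ (φ s) x x - φ s x) x : ℝ) : EReal))) := by
  refine isBestConstant_of_forall_iff_le fun α => ?_
  rw [contractsOn_iff_subhomogeneousOn hC hφ hU hUD hUC hUscale hmono, EReal.le_neg]
  simp only [iSup_le_iff]
  refine forall₂_congr fun s hs => ?_
  rw [subhomogeneousOn_iff_fderiv hUscale (hdiff s hs)]
  refine forall₂_congr fun x hx => ?_
  rw [← EReal.coe_neg, EReal.coe_le_coe_iff, coneM_le_iff hC (hUC hx)]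

theorem mainTheorem1 {X : Type*} [NormedAddCommGroup X] [NormedSpace ℝ X] [CompleteSpace X]
    [Nontrivial X]
    (C : ProperCone ℝ X) (hC : ∀ x : X, x ∈ C → -x ∈ C → x = 0)
    (T : EReal) (D : Set X) (hD : IsOpen D) (φ : ℝ → X → X)
    (hcont : ContinuousOn (fun p : ℝ × X => φ p.1 p.2) (ThompsonFlow.halfOpen 0 T ×ˢ D))
    (hdiff : ∀ t ∈ ThompsonFlow.halfOpen 0 T, ∀ x ∈ D, DifferentiableAt ℝ (φ t) x)
    (hbound : ∀ K : Set X, K ⊆ D → IsClosed K → Bornology.IsBounded K →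
      ∃ L : ℝ, ∀ t ∈ ThompsonFlow.halfOpen 0 T, ∀ x ∈ K, ‖fderiv ℝ (φ t) x‖ ≤ L)
    (U : Set X) (hU : IsOpen U) (hUD : U ⊆ D) (hUC : U ⊆ interior (C : Set X))
    (hUscale : ∀ l : ℝ, 0 < l → l ≤ 1 → ∀ x ∈ U, l • x ∈ U)
    (hmono : ThompsonFlow.OrderPreservingOn C T D φ U) :
    ThompsonFlow.IsBestConstant (ThompsonFlow.ContractsOn C T D φ U)
      (-(⨆ s ∈ ThompsonFlow.halfOpen 0 T, ⨆ x ∈ U,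
        ((ThompsonFlow.coneM C (fderiv ℝ (φ s) x x - φ s x) x : ℝ) : EReal))) := by
  exact mainTheorem1_general (ne_top_of_salient hC)
    (isLocallyLipschitzField_of_norm_fderiv_le hD hcont hdiff hbound) hU hUD hUC hUscale
    (fun t ht x hx => hdiff t ht x (hUD hx)) hmono
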